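/- Let $n\ge 2$, let $\mathscr{C}\subset\mathbb{R}^n$ be an $n$-dimensional simplicial cone with vertex at the origin $\boldsymbol{0}$, and suppose that $\mathscr{C}$ is irrational, that is, the planes spanned by its proper faces contain no point of $\mathbb{Z}^n$ except $\boldsymbol{0}$. Let $K$ be the convex hull of the nonzero points of $\mathbb{Z}^n$ contained in $\mathscr{C}$ (the Klein polyhedron), and let $\Pi=\partial K$ be its sail; the vertices, edges and faces of $\Pi$ are those of $K$ contained in $\Pi$. For a vertex $\mathbf{v}$ of $\Pi$ let $\mathbf{r}_1,\dots,\mathbf{r}_m$ be the primitive vectors of $\mathbb{Z}^n$ parallel to the edges of $\Pi$ incident to $\mathbf{v}$ (one for each edge), and let $$\det \mathrm{St}_{\mathbf{v}}=\sum_{1\le i_1<\dots<i_n\le m}|\det(\mathbf{r}_{i_1},\dots,\mathbf{r}_{i_n})|$$ be the determinant of the edge star of $\mathbf{v}$. For an $(n-1)$-dimensional face $F$ of $\Pi$ let $\rho_{\mathrm{int}}(F,\boldsymbol{0})$, the integer distance from $F$ to $\boldsymbol{0}$, be the index in $\mathbb{Z}^n$ of the smallest sublattice of $\mathbb{Z}^n$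 containing $\mathbb{Z}^n\cap\mathrm{aff}(F)$. Then, for every vertex $\mathbf{v}$ of $\Pi$ and every $(n-1)$-dimensional face $F$ of $\Pi$ incident to $\mathbf{v}$, this index is finite and $$\rho_{\mathrm{int}}(F,\boldsymbol{0})<(n\det \mathrm{St}_{\mathbf{v}})^{8\,n!}.$$ -/

import Mathlib

open scoped Nat

noncomputable section

namespace KleinSail

/-- The point of `ℝⁿ` with the given integer coordinates. -/
def toReal {n : ℕ} (z : Fin n → ℤ) : Fin n → ℝ := fun i => (z i : ℝ)

/-- The `n`-dimensional simplicial cone with vertex at the origin that is generated by the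
basis `b` of `ℝⁿ`: all linear combinations of the basis vectors with nonnegative coefficients. -/
def simplicialCone {n : ℕ} (b : Module.Basis (Fin n) ℝ (Fin n → ℝ)) : Set (Fin n → ℝ) :=
  {x | ∃ c : Fin n → ℝ, (∀ i, 0 ≤ c i) ∧ x = ∑ i, c i • b i}

/-- The cone generated by `b` is irrational: the plane spanned by a proper face of the cone
(the proper faces are generated by the proper subfamilies of `b`) contains no point of `ℤⁿ`
except the origin. -/
def IsIrrational {n : ℕ} (b : Module.Basis (Fin n) ℝ (Fin n → ℝ)) : Prop :=
  ∀ s : Set (Fin n), s ≠ Set.univ →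
    ∀ z : Fin n → ℤ, toReal z ∈ Submodule.span ℝ (b '' s) → z = 0

/-- The Klein polyhedron of a cone `C`: the convex hull of the nonzero points of `ℤⁿ` in `C`. -/
def kleinPolyhedron {n : ℕ} (C : Set (Fin n → ℝ)) : Set (Fin n → ℝ) :=
  convexHull ℝ {x | x ∈ C ∧ ∃ z : Fin n → ℤ, z ≠ 0 ∧ toReal z = x}

/-- The sail of a cone `C`: the boundary of its Klein polyhedron. -/
def sail {n : ℕ} (C : Set (Fin n → ℝ)) : Set (Fin n → ℝ) :=
  frontier (kleinPolyhedron C)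

/-- `F` is a `k`-dimensional face of the convex set `K`: a nonempty intersection of `K` with a
supporting hyperplane (or `K` itself), whose affine hull has dimension `k`. -/
def IsFaceOfDim {n : ℕ} (K : Set (Fin n → ℝ)) (k : ℕ) (F : Set (Fin n → ℝ)) : Prop :=
  F.Nonempty ∧ IsExposed ℝ K F ∧ Module.finrank ℝ (affineSpan ℝ F).direction = k

/-- `F` is a `k`-dimensional face of the sail of `C`: a `k`-dimensional face of the Klein
polyhedron that lies in the sail. -/
def IsSailFace {n : ℕ} (C : Set (Fin n → ℝ)) (k : ℕ) (F : Set (Fin n → ℝ)) : Prop :=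
  IsFaceOfDim (kleinPolyhedron C) k F ∧ F ⊆ sail C

/-- `v` is a vertex (a zero-dimensional face) of the sail of `C`. -/
def IsSailVertex {n : ℕ} (C : Set (Fin n → ℝ)) (v : Fin n → ℝ) : Prop :=
  IsSailFace C 0 {v}

/-- `r` is a primitive vector of `ℤⁿ`: its coordinates have no common divisor except `±1`. -/
def IsPrimitiveVector {n : ℕ} (r : Fin n → ℤ) : Prop :=
  ∀ d : ℤ, (∀ i, d ∣ r i) → IsUnit d

/-- The primitive vectors of `ℤⁿ` parallel to the edges of the sail that are incident to `v`,
one for each edge: the one that points from `v` into the edge. -/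
def edgeVectors {n : ℕ} (C : Set (Fin n → ℝ)) (v : Fin n → ℝ) : Set (Fin n → ℤ) :=
  {r | IsPrimitiveVector r ∧
    ∃ E, IsSailFace C 1 E ∧ v ∈ E ∧ ∃ t : ℝ, 0 < t ∧ v + t • toReal r ∈ E}

/-- The absolute value of the determinant of the `n` vectors in `s` (it does not depend on the
order in which they are listed). -/
def absDet {n : ℕ} (s : Finset (Fin n → ℤ)) (h : s.card = n) : ℕ :=
  (Matrix.det (Matrix.of fun i : Fin n => ((s.equivFinOfCardEq h).symm i : Fin n → ℤ))).natAbs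

/-- The determinant of the edge star of the vertex `v` of the sail of `C`: the sum of the
absolute values of the determinants of all `n`-element subfamilies of the primitive vectors
parallel to the edges incident to `v`. -/
def starDet {n : ℕ} (C : Set (Fin n → ℝ)) (v : Fin n → ℝ) : ℕ :=
  ∑ᶠ s : {s : Finset (Fin n → ℤ) // (s : Set (Fin n → ℤ)) ⊆ edgeVectors C v ∧ s.card = n},
    absDet s.1 s.2.2

/-- The integer distance from `F` to the integer point `a`: the index in `ℤⁿ` of the smallest
subgroup that contains `ℤⁿ ∩ aff F - a`; the value is `⊤` if this index is infinite. -/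
def intDist {n : ℕ} (F : Set (Fin n → ℝ)) (a : Fin n → ℤ) : ℕ∞ :=
  ENat.card ((Fin n → ℤ) ⧸
    AddSubgroup.closure {z : Fin n → ℤ | toReal (z + a) ∈ affineSpan ℝ F})

end KleinSail

end

/-! Seen from a vertex w, the Klein polyhedron spans a cone generated by a finite irredundant set
`Y` of integer vectors (`exists_isLocalFrame`), and every element of `Y` is a positive multiple of
an edge vector (`exists_edgeVector`). A facet F through w has n - 1 independent edge vectors g_j in
its direction, and its plane misses the origin (`exists_facet_edgeVectors`), so Δ = det(w, g_1, ...,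
g_{n-1}) is nonzero. The sublattice that defines the integer distance contains w and all g_j, hence
its index is at most |Δ|.

Since 2w is a point of the polyhedron, w itself lies in the cone of `Y`, and Carathéodory's theorem
gives w = ∑ lam_i r_i with edge vectors r_i and lam_i ≥ 0. Linearity in the first row yields |Δ| ≤
(∑ lam_i) det St_w.

It remains to bound S = ∑ lam_i in terms of n alone (`sum_add_one_le`). If S is large, Diophantine
approximation gives a nonzero integer vector y ≥ 0 such that w - ∑ y_i r_i is still a positive
combination of the points w + r_i, hence a lattice point inside the cone. But a linear form minimal
at w takes a smaller value there, a contradiction. The approximation must be good relative to each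
lam_i, although these may differ widely in size. A gap in a tower of scales separates large
coordinates, to which Dirichlet's theorem applies, from small ones, which are rounded to 0; the
tower produces the factorial exponent. -/

open scoped Nat

noncomputable section

namespace KleinSail

/-! ### Diophantine approximation at a gap between scales -/

/-- Dirichlet's theorem on simultaneous approximation. -/
theorem exists_simultaneous_approx {ι : Type*} (I : Finset ι) (α : ι → ℝ) {M : ℕ} (hM : 0 < M) :
    ∃ q : ℕ, 0 < q ∧ q ≤ M ^ I.card ∧
      ∃ z : ι → ℤ, ∀ i ∈ I, |(q : ℝ) * α i - z i| < 1 / M := by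
  classical
  have hM' : (0 : ℝ) < M := by exact_mod_cast hM
  -- The unit cube is cut into `M ^ I.card` cells; two of the first `M ^ I.card + 1` multiples of
  -- `α` share a cell modulo 1, and `q` is the difference of their indices.
  let box : Fin (M ^ I.card + 1) → (I → Fin M) := fun j i =>
    ⟨⌊(M : ℝ) * Int.fract ((j : ℕ) * α i)⌋₊, by
      rw [Nat.floor_lt (by positivity)]
      have := Int.fract_lt_one (((j : ℕ) : ℝ) * α i)
      nlinarith⟩
  have key : ∃ j k : Fin (M ^ I.card + 1), j < k ∧ box j = box k := by
    obtain ⟨j, k, hjk, h⟩ := Fintype.exists_ne_map_eq_of_card_lt box (by simp)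
    rcases lt_or_gt_of_ne hjk with h' | h'
    · exact ⟨j, k, h', h⟩
    · exact ⟨k, j, h', h.symm⟩
  obtain ⟨j, k, hjk, h⟩ := key
  have hjk' : (j : ℕ) < k := hjk
  refine ⟨k - j, by omega, by have := k.2; omega,
    fun i => ⌊((k : ℕ) : ℝ) * α i⌋ - ⌊((j : ℕ) : ℝ) * α i⌋, fun i hi => ?_⟩
  have hfl := congrArg Fin.val (congrFun h ⟨i, hi⟩)
  simp only [box] at hfl
  set a := Int.fract (((j : ℕ) : ℝ) * α i) with ha
  set c := Int.fract (((k : ℕ) : ℝ) * α i) with hc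
  have h1 := Nat.floor_le (a := (M : ℝ) * a) (by positivity)
  have h2 := Nat.lt_floor_add_one ((M : ℝ) * a)
  have h3 := Nat.floor_le (a := (M : ℝ) * c) (by positivity)
  have h4 := Nat.lt_floor_add_one ((M : ℝ) * c)
  rw [hfl] at h1 h2
  have e : (((k - j : ℕ) : ℝ)) * α i -
      ((⌊((k : ℕ) : ℝ) * α i⌋ - ⌊((j : ℕ) : ℝ) * α i⌋ : ℤ) : ℝ) = c - a := by
    rw [ha, hc, Int.fract, Int.fract, Nat.cast_sub hjk'.le]
    push_cast
    ring
  rw [e, abs_lt, lt_div_iff₀ hM', neg_lt, ← neg_lt, ← neg_div, div_lt_iff₀ hM']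
  constructor <;> nlinarith

/-- A rapidly growing sequence of scales. -/
def scale (n : ℕ) : ℕ → ℕ
  | 0 => n + 1
  -- The power is Dirichlet's bound on `q` for `j + 1` numbers at precision `1 / scale n j`. With
  -- the factor `2 * n`, a number below the next scale, multiplied by `q`, stays below `1 / (2 *
  -- n)`.
  | j + 1 => 2 * n * scale n j ^ (j + 1)

theorem scale_pos {n : ℕ} (hn : 0 < n) (j : ℕ) : 0 < scale n j := by
  induction j with
  | zero => simp [scale]
  | succ j ih => simp only [scale]; positivity

theorem scale_le_scale_succ {n : ℕ} (hn : 0 < n) (j : ℕ) : scale n j ≤ scale n (j + 1) := by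
  have h := scale_pos hn j
  calc scale n j = 1 * scale n j ^ 1 := by simp
    _ ≤ 2 * n * scale n j ^ (j + 1) :=
      Nat.mul_le_mul (by omega) (Nat.pow_le_pow_right h (by omega))

/-- Keeps the sum of `j + 1` rounding errors of size `1 / scale n j` within 1/2. -/
theorem two_mul_succ_le_scale {n j : ℕ} (hj : j < n) : 2 * (j + 1) ≤ scale n j := by
  cases j with
  | zero => simp [scale]; omega
  | succ j =>
    have h := Nat.pow_pos (n := j + 1) (scale_pos (by omega : 0 < n) j)
    simp only [scale]
    nlinarith

/-- The `- 2` is slack for the induction: the power `j + 2` turns it into `2 * (j + 2) ≥ 4`, which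
pays for the new factor `2 * n ≤ n ^ 2` and restores the slack. -/
theorem scale_le_pow {n : ℕ} (hn : 2 ≤ n) (j : ℕ) :
    scale n (j + 1) ≤ n ^ (6 * (j + 1)! - 2) := by
  induction j with
  | zero =>
    have h : 2 * n * (n + 1) ≤ n ^ 4 := by
      have : n ^ 4 = n * n * (n * n) := by ring
      rw [this]
      have h1 : n + 1 ≤ n * n := by nlinarith
      exact Nat.mul_le_mul (by nlinarith) h1
    simpa [scale] using h
  | succ j ih =>
    have hf : 1 ≤ (j + 1)! := Nat.factorial_pos _
    calc scale n (j + 1 + 1) = 2 * n * scale n (j + 1) ^ (j + 2) := rfl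
      _ ≤ n ^ 2 * (n ^ (6 * (j + 1)! - 2)) ^ (j + 2) :=
        Nat.mul_le_mul (by nlinarith) (Nat.pow_le_pow_left ih _)
      _ = n ^ (2 + (6 * (j + 1)! - 2) * (j + 2)) := by rw [← pow_mul, ← pow_add]
      _ ≤ n ^ (6 * (j + 1 + 1)! - 2) := by
        apply Nat.pow_le_pow_right (by omega)
        rw [Nat.factorial_succ (j + 1)]
        obtain ⟨t, ht⟩ : ∃ t, (j + 1)! = t + 1 := ⟨(j + 1)! - 1, by omega⟩
        rw [ht]
        have h1 : 6 * (t + 1) - 2 = 6 * t + 4 := by omega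
        rw [h1]
        have h2 : 6 * ((j + 1 + 1) * (t + 1)) = (6 * t + 4) * (j + 2) + 2 * (j + 2) := by ring
        rw [h2]
        omega

/-- Among `n + 1` nonnegative numbers with sum one, one of which is tiny, there is a gap between
two consecutive scales such that only few numbers are above it. -/
theorem exists_scale_gap {n : ℕ} (hn : 0 < n) (α : Option (Fin n) → ℝ)
    (hsum : ∑ i, α i = 1) (hnone : α none < 1 / scale n n) :
    ∃ j < n, ∃ I : Finset (Option (Fin n)), I.card = j + 1 ∧
      (∀ i ∈ I, 1 / (scale n j : ℝ) ≤ α i) ∧ (∀ i ∉ I, α i < 1 / (scale n (j + 1) : ℝ)) := by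
  classical
  let I : ℕ → Finset (Option (Fin n)) := fun j =>
    Finset.univ.filter fun i => 1 / (scale n j : ℝ) ≤ α i
  have hmono : ∀ j, I j ⊆ I (j + 1) := by
    intro j i hi
    simp only [I, Finset.mem_filter, Finset.mem_univ, true_and] at hi ⊢
    refine le_trans ?_ hi
    apply one_div_le_one_div_of_le
    · exact_mod_cast scale_pos hn j
    · exact_mod_cast scale_le_scale_succ hn j
  have hex : ∃ j, (I (j + 1)).card ≤ j + 1 := by
    refine ⟨n - 1, ?_⟩
    have : n - 1 + 1 = n := by omega
    rw [this]
    have hn' : none ∉ I n := by simpa [I] using hnone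
    have := Finset.card_lt_univ_of_notMem hn'
    simp at this
    omega
  -- By minimality `I j` has at least `j + 1` elements (for `j = 0` because some number reaches the
  -- mean `1 / (n + 1)`), while `I (j + 1)` has at most `j + 1`; being nested, they coincide.
  let j := Nat.find hex
  have hj : (I (j + 1)).card ≤ j + 1 := Nat.find_spec hex
  have hjn : j < n := by
    have : j ≤ n - 1 := by
      apply Nat.find_min'
      have : n - 1 + 1 = n := by omega
      rw [this]
      have hn' : none ∉ I n := by simpa [I] using hnone
      have := Finset.card_lt_univ_of_notMem hn'
      simp at this
      omega
    omega
  have hlow : j + 1 ≤ (I j).card := by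
    rcases Nat.eq_zero_or_pos j with h0 | h0
    · rw [h0, zero_add, Nat.one_le_iff_ne_zero, Finset.card_ne_zero]
      by_contra hne
      rw [Finset.not_nonempty_iff_eq_empty] at hne
      have hlt : ∀ i, α i < 1 / ((n : ℝ) + 1) := by
        intro i
        by_contra hi
        have : i ∈ I 0 := by simpa [I, scale] using hi
        simp [hne] at this
      have : ∑ i, α i < ∑ _i : Option (Fin n), 1 / ((n : ℝ) + 1) :=
        Finset.sum_lt_sum_of_nonempty ⟨none, Finset.mem_univ _⟩ fun i _ => hlt i
      rw [hsum] at this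
      simp only [Finset.sum_const, Finset.card_univ, Fintype.card_option, Fintype.card_fin,
        nsmul_eq_mul, Nat.cast_add, Nat.cast_one] at this
      rw [mul_one_div_cancel (by positivity)] at this
      exact lt_irrefl _ this
    · have h1 := Nat.find_min hex (m := j - 1) (by omega)
      have h2 : j - 1 + 1 = j := by omega
      rw [h2] at h1
      omega
  have heq : I j = I (j + 1) :=
    Finset.eq_of_subset_of_card_le (hmono j) (by omega)
  refine ⟨j, hjn, I j, ?_, ?_, ?_⟩
  · have := Finset.card_le_card (hmono j)
    omega
  · intro i hi
    simpa [I] using hi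
  · intro i hi
    rw [heq] at hi
    simpa [I] using hi

/-- If the coordinates `lam` of a vector are large, there is a nonzero nonnegative integer vector
`y` which is, coordinate by coordinate, at most the multiple of `lam` of almost the same size. -/
theorem exists_integer_vector_below {n : ℕ} (hn : 2 ≤ n) (lam : Fin n → ℝ) (h0 : ∀ i, 0 ≤ lam i)
    (hS : (n : ℝ) ^ (6 * (n)! - 2) < ∑ i, lam i + 1) :
    ∃ y : Fin n → ℤ, (∀ i, 0 ≤ y i) ∧ 0 < ∑ i, y i ∧ ((∑ i, y i : ℤ) : ℝ) < ∑ i, lam i ∧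
      ∀ i, (y i : ℝ) * (∑ i, lam i + 1) ≤ (1 + ((∑ i, y i : ℤ) : ℝ)) * lam i := by
  classical
  set N : ℝ := ∑ i, lam i + 1 with hN
  have hNpos : 0 < N := by have := Finset.sum_nonneg fun i (_ : i ∈ Finset.univ) => h0 i; linarith
  have hn0 : 0 < n := by omega
  have hscale : (scale n n : ℝ) < N := by
    have h := scale_le_pow hn (n - 1)
    have e : n - 1 + 1 = n := by omega
    rw [e] at h
    refine lt_of_le_of_lt ?_ hS
    exact_mod_cast h
  -- The extra entry `1 / N` makes the sum 1 and is too small ever to be approximated.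
  let α : Option (Fin n) → ℝ := fun i => i.elim (1 / N) fun i => lam i / N
  have hα0 : ∀ i, 0 ≤ α i := by
    rintro (_ | i)
    · exact (one_div_pos.2 hNpos).le
    · exact div_nonneg (h0 i) hNpos.le
  have hαsum : ∑ i, α i = 1 := by
    rw [Fintype.sum_option]
    simp only [α, Option.elim]
    rw [← Finset.sum_div, ← add_div, add_comm, ← hN, div_self hNpos.ne']
  have hsp : ∀ j, (0 : ℝ) < scale n j := fun j => by exact_mod_cast scale_pos hn0 j
  obtain ⟨j, hj, I, hI, hlow, hhigh⟩ := exists_scale_gap hn0 α hαsum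
    (one_div_lt_one_div_of_lt (hsp n) hscale)
  obtain ⟨q, hq0, hqM, z, hz⟩ := exists_simultaneous_approx I α (scale_pos hn0 j)
  rw [hI] at hqM
  have hM2 : 2 * ((j : ℝ) + 1) ≤ (scale n j : ℝ) := by exact_mod_cast two_mul_succ_le_scale hj
  have hqM' : (q : ℝ) ≤ (scale n j : ℝ) ^ (j + 1) := by exact_mod_cast hqM
  set M : ℝ := (scale n j : ℝ) with hM
  have hMpos : 0 < M := hsp j
  have hM' : (scale n (j + 1) : ℝ) = 2 * n * M ^ (j + 1) := by simp [scale, hM]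
  have hmono : scale n (j + 1) ≤ scale n n :=
    monotone_nat_of_le_succ (scale_le_scale_succ hn0) hj
  have hq1 : (1 : ℝ) ≤ q := by exact_mod_cast hq0
  have hnR : (2 : ℝ) ≤ n := by exact_mod_cast hn
  have hqN : (q : ℝ) + 1 < N := by
    have h1 : (scale n (j + 1) : ℝ) ≤ scale n n := by exact_mod_cast hmono
    nlinarith
  have hnone : none ∉ I := by
    intro h
    have h1 := hlow _ h
    have h2 : (scale n j : ℝ) ≤ scale n n := by
      exact_mod_cast monotone_nat_of_le_succ (scale_le_scale_succ hn0) hj.le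
    have h3 : 1 / N < 1 / M := one_div_lt_one_div_of_lt hMpos (by linarith)
    simp only [α, Option.elim] at h1
    linarith
  let y' : Option (Fin n) → ℤ := fun i => if i ∈ I then z i else 0
  have hy'none : y' none = 0 := by simp [y', hnone]
  have hy'0 : ∀ i, 0 ≤ y' i := by
    intro i
    by_cases hi : i ∈ I
    · simp only [y', hi, if_true]
      have h1 := (abs_lt.1 (hz i hi)).2
      have h2 : 1 / M ≤ 1 := by
        rw [div_le_one hMpos]; have : (0 : ℝ) ≤ j := by positivity
        linarith
      have h3 : 0 ≤ (q : ℝ) * α i := mul_nonneg (by linarith) (hα0 i)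
      have h4 : (-1 : ℝ) < z i := by linarith
      have h5 : (-1 : ℤ) < z i := by exact_mod_cast h4
      omega
    · simp [y', hi]
  -- Rounding on `I` and dropping the other entries cost at most 1/2 each, strictly less in total
  -- because `I` is nonempty. Hence the integer `∑ y'` equals `q`.
  have hdiff : |∑ i, ((q : ℝ) * α i - y' i)| < 1 := by
    have hle : ∀ i, |(q : ℝ) * α i - y' i| ≤ if i ∈ I then 1 / M else 1 / (2 * n) := by
      intro i
      by_cases hi : i ∈ I
      · simpa only [y', hi, if_true] using (hz i hi).le
      · simp only [y', hi, if_false, Int.cast_zero, sub_zero]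
        rw [abs_of_nonneg (mul_nonneg (by linarith) (hα0 i))]
        have h1 := (hhigh i hi).le
        rw [hM'] at h1
        calc (q : ℝ) * α i ≤ M ^ (j + 1) * (1 / (2 * n * M ^ (j + 1))) :=
              mul_le_mul hqM' h1 (hα0 i) (by positivity)
          _ = 1 / (2 * n) := by field_simp
    obtain ⟨i₀, hi₀⟩ : I.Nonempty := by rw [← Finset.card_pos]; omega
    have hsum : ∑ i, (if i ∈ I then 1 / M else 1 / (2 * n)) ≤ 1 := by
      rw [Finset.sum_ite]
      simp only [Finset.sum_const, nsmul_eq_mul]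
      have c1 : (Finset.univ.filter fun i => i ∈ I).card = j + 1 := by
        rw [Finset.filter_mem_eq_inter, Finset.univ_inter, hI]
      have c2 : (Finset.univ.filter fun i => i ∉ I).card ≤ n := by
        have h := Finset.card_filter_add_card_filter_not (s := (Finset.univ : Finset (Option (Fin n))))
          (fun i => i ∈ I)
        rw [c1] at h
        simp at h
        omega
      rw [c1]
      have h1 : ((j + 1 : ℕ) : ℝ) * (1 / M) ≤ 1 / 2 := by
        push_cast
        rw [mul_one_div, div_le_div_iff₀ hMpos (by norm_num)]
        linarith
      have h2 : (((Finset.univ.filter fun i => i ∉ I).card : ℕ) : ℝ) * (1 / (2 * n)) ≤ 1 / 2 := by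
        rw [mul_one_div, div_le_div_iff₀ (by positivity) (by norm_num)]
        have : (((Finset.univ.filter fun i => i ∉ I).card : ℕ) : ℝ) ≤ n := by exact_mod_cast c2
        linarith
      linarith
    calc |∑ i, ((q : ℝ) * α i - y' i)| ≤ ∑ i, |(q : ℝ) * α i - y' i| :=
          Finset.abs_sum_le_sum_abs _ _
      _ < ∑ i, (if i ∈ I then 1 / M else 1 / (2 * n)) := by
        refine Finset.sum_lt_sum (fun i _ => hle i) ⟨i₀, Finset.mem_univ _, ?_⟩
        simpa only [y', hi₀, if_true] using hz i₀ hi₀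
      _ ≤ 1 := hsum
  have hY : ∑ i, y' i = q := by
    rw [Finset.sum_sub_distrib, ← Finset.mul_sum, hαsum, mul_one] at hdiff
    have h1 : |((q : ℤ) - ∑ i, y' i : ℤ)| < 1 := by
      have : |(((q : ℤ) - ∑ i, y' i : ℤ) : ℝ)| < 1 := by push_cast; exact hdiff
      exact_mod_cast this
    rw [Int.abs_lt_one_iff] at h1
    omega
  have hY' : ∑ i, y' (some i) = q := by
    rw [← hY, Fintype.sum_option, hy'none, zero_add]
  refine ⟨fun i => y' (some i), fun i => hy'0 _, ?_, ?_, ?_⟩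
  · rw [hY']; exact_mod_cast hq0
  · rw [hY']
    have : ((q : ℤ) : ℝ) = q := by simp
    rw [this]
    linarith
  · intro i
    rw [hY']
    have e : ((q : ℤ) : ℝ) = q := by simp
    rw [e]
    have hαi : lam i = α (some i) * N := by
      simp only [α, Option.elim]
      field_simp
    -- On `I` the rounding error is below `1 / M`, which is at most `α` itself: this is where
    -- membership above the scale is used.
    have key : (y' (some i) : ℝ) ≤ (1 + q) * α (some i) := by
      by_cases hi : some i ∈ I
      · simp only [y', hi, if_true]
        have h1 := (abs_lt.1 (hz _ hi)).1
        have h2 := hlow _ hi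
        linarith
      · simp only [y', hi, if_false, Int.cast_zero]
        exact mul_nonneg (by positivity) (hα0 _)
    rw [hαi, ← mul_assoc]
    exact mul_le_mul_of_nonneg_right key hNpos.le

/-! ### Finitely generated cones and their extreme rays -/

/-- Carathéodory's theorem for cones. -/
theorem exists_linearIndepOn_sum_eq {E : Type*} [AddCommGroup E] [Module ℝ E]
    (s : Finset E) (c : E → ℝ) (hc : ∀ x ∈ s, 0 ≤ c x) :
    ∃ t ⊆ s, LinearIndepOn ℝ id (t : Set E) ∧ ∃ d : E → ℝ, (∀ x ∈ t, 0 ≤ d x) ∧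
      ∑ x ∈ t, d x • x = ∑ x ∈ s, c x • x := by
  classical
  induction s using Finset.strongInduction generalizing c with
  | H s ih =>
    by_cases hs : LinearIndepOn ℝ id (s : Set E)
    · exact ⟨s, subset_rfl, hs, c, hc, rfl⟩
    rw [not_linearIndepOn_finset_iff] at hs
    have hpos : ∃ g : E → ℝ, ∑ x ∈ s, g x • x = 0 ∧ ∃ x ∈ s, 0 < g x := by
      obtain ⟨g, hg, x, hx, hgx⟩ := hs
      rcases lt_or_gt_of_ne hgx with h | h
      · refine ⟨fun x => -g x, ?_, x, hx, by linarith⟩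
        simpa [neg_smul, Finset.sum_neg_distrib] using hg
      · exact ⟨g, hg, x, hx, h⟩
    obtain ⟨g, hg, x₀, hx₀, hgx₀⟩ := hpos
    -- Subtracting the dependence `g` with the smallest ratio kills the coefficient of `m` and keeps
    -- the others nonnegative.
    obtain ⟨m, hm, hmin⟩ := (s.filter fun x => 0 < g x).exists_min_image (fun x => c x / g x)
      ⟨x₀, Finset.mem_filter.2 ⟨hx₀, hgx₀⟩⟩
    rw [Finset.mem_filter] at hm
    obtain ⟨hms, hgm⟩ := hm
    set ρ := c m / g m with hρ
    have hρ0 : 0 ≤ ρ := div_nonneg (hc m hms) hgm.le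
    obtain ⟨t, hts, hti, d, hd, hsum⟩ := ih (s.erase m) (Finset.erase_ssubset hms)
      (fun x => c x - ρ * g x) (fun x hx => by
        have hxs := Finset.mem_of_mem_erase hx
        by_cases hgx : 0 < g x
        · have := hmin x (Finset.mem_filter.2 ⟨hxs, hgx⟩)
          rw [le_div_iff₀ hgx] at this
          linarith
        · have := hc x hxs
          nlinarith)
    refine ⟨t, hts.trans (Finset.erase_subset _ _), hti, d, hd, ?_⟩
    rw [hsum]
    have hzero : (c m - ρ * g m) • m = 0 := by
      rw [hρ, div_mul_cancel₀ _ hgm.ne', sub_self, zero_smul]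
    rw [Finset.sum_erase s (f := fun x => (c x - ρ * g x) • x) hzero]
    simp only [sub_smul, mul_smul, Finset.sum_sub_distrib, ← Finset.smul_sum, hg, smul_zero,
      sub_zero]

/-- The integer points strictly inside a translated cone all of whose nonzero points are positive
for a linear form are generated by finitely many of them. -/
theorem exists_finite_generating {M ι : Type*} [AddCommGroup M] [Finite ι] (L : ι → M →+ ℝ)
    (a : ι → ℝ) (ha : ∀ i, 0 < a i) (f : M →+ ℝ)
    (hf : ∀ z, (∀ i, 0 < a i + L i z) → z ≠ 0 → 0 < f z) :
    ∃ G : Set M, G.Finite ∧ (∀ g ∈ G, g ≠ 0 ∧ ∀ i, 0 < a i + L i g) ∧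
      ∀ z, (∀ i, 0 < a i + L i z) → z ∈ AddSubmonoid.closure G := by
  classical
  let Q : Set M := {z | ∀ i, 0 < a i + L i z}
  have hQ : ∀ z, z ∈ Q ↔ ∀ i, 0 < a i + L i z := fun z => Iff.rfl
  -- Measured in units of `a i`, rounding down loses less than one unit, exactly the room that `Q`
  -- leaves for a difference: `Φ z ≤ Φ z'` implies `z' - z ∈ Q`. This makes Dickson's lemma in `ι →
  -- ℕ` applicable although the data are real.
  let Φ : M → ι → ℕ := fun z i => ⌊(a i + L i z) / a i⌋₊
  have hΦ : ∀ z ∈ Q, ∀ z', Φ z ≤ Φ z' → z' ∈ Q → z' - z ∈ Q := by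
    intro z _ z' h hz' i
    have h1 := Nat.lt_floor_add_one ((a i + L i z) / a i)
    have h2 := Nat.floor_le (div_nonneg (hz' i).le (ha i).le)
    have h3 : ((Φ z i : ℕ) : ℝ) ≤ Φ z' i := by exact_mod_cast h i
    have h4 : (a i + L i z) / a i < (a i + L i z') / a i + 1 := by
      simp only [Φ] at h3
      linarith
    rw [div_add_one (ha i).ne', div_lt_div_iff_of_pos_right (ha i)] at h4
    rw [map_sub]
    linarith
  have hinj : Set.InjOn Φ Q := by
    intro z hz z' hz' h
    by_contra hne
    have h1 := hf _ (hΦ z hz z' h.le hz') (sub_ne_zero.2 (Ne.symm hne))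
    have h2 := hf _ (hΦ z' hz' z h.ge hz) (sub_ne_zero.2 hne)
    rw [map_sub] at h1 h2
    linarith
  let S : Set (ι → ℕ) := Φ '' {z | z ∈ Q ∧ z ≠ 0}
  let G : Set M := {z | (z ∈ Q ∧ z ≠ 0) ∧ Minimal (· ∈ S) (Φ z)}
  have hGfin : G.Finite := by
    refine Set.Finite.of_finite_image (f := Φ) ?_ (hinj.mono fun z hz => hz.1.1)
    refine Set.Finite.subset ((setOfPred_minimal_antichain (· ∈ S)).finite_of_wellQuasiOrdered
      wellQuasiOrdered_le) ?_
    rintro _ ⟨z, hz, rfl⟩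
    exact hz.2
  refine ⟨G, hGfin, fun g hg => ⟨hg.1.2, hg.1.1⟩, ?_⟩
  -- The values of `f` need not be discrete; an infinite descent is excluded because two of its
  -- members would be comparable under `Φ`, and their difference would be in `Q` with negative `f`.
  have hwf : WellFounded fun x y : Q => f x < f y := by
    rw [wellFounded_iff_isEmpty_descending_chain]
    refine ⟨fun ⟨u, hu⟩ => ?_⟩
    obtain ⟨k, m, hkm, h⟩ := wellQuasiOrdered_le (α := ι → ℕ) fun k => Φ (u k)
    have hanti : StrictAnti fun k => f (u k) := strictAnti_nat_of_succ_lt hu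
    have hlt : f (u m) < f (u k) := hanti hkm
    have h1 := hΦ _ (u k).2 _ h (u m).2
    have h2 := hf _ h1 (fun h0 => by
      rw [sub_eq_zero] at h0
      rw [h0] at hlt
      exact lt_irrefl _ hlt)
    rw [map_sub] at h2
    linarith
  intro z hz
  have key : ∀ x : Q, (x : M) ∈ AddSubmonoid.closure G := by
    intro x
    induction x using hwf.induction with
    | _ x ih =>
      by_cases hx0 : (x : M) = 0
      · rw [hx0]; exact zero_mem _
      have hxS : Φ x ∈ S := ⟨x, ⟨x.2, hx0⟩, rfl⟩
      by_cases hmin : Minimal (· ∈ S) (Φ x)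
      · exact AddSubmonoid.subset_closure ⟨⟨x.2, hx0⟩, hmin⟩
      obtain ⟨_, hlt, y, ⟨hyQ, hy0⟩, rfl⟩ := exists_lt_of_not_minimal hxS hmin
      have hd := hΦ y hyQ x hlt.le x.2
      have hne : (x : M) - y ≠ 0 := by
        rw [sub_ne_zero]
        intro h
        rw [h] at hlt
        exact lt_irrefl _ hlt
      have hfd := hf _ hd hne
      have hfy := hf _ hyQ hy0
      rw [map_sub] at hfd
      have h1 := ih ⟨y, hyQ⟩ (by simpa using hfd)
      have h2 := ih ⟨x - y, hd⟩ (by simp only [map_sub]; linarith)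
      have := add_mem h1 h2
      simpa using this
  exact key ⟨z, hz⟩

/-- A finite set of vectors contains an irredundant set generating the same cone. -/
theorem exists_irredundant_hull_eq {E : Type*} [AddCommGroup E] [Module ℝ E] {X : Set E}
    (hX : X.Finite) : ∃ Y ⊆ X, PointedCone.hull ℝ Y = PointedCone.hull ℝ X ∧
      ∀ y ∈ Y, y ∉ PointedCone.hull ℝ (Y \ {y}) := by
  induction h : X.ncard using Nat.strong_induction_on generalizing X with
  | _ m ih =>
    by_cases hred : ∀ y ∈ X, y ∉ PointedCone.hull ℝ (X \ {y})
    · exact ⟨X, subset_rfl, rfl, hred⟩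
    push Not at hred
    obtain ⟨y, hy, hyX⟩ := hred
    obtain ⟨Y, hYX, hY, hirr⟩ := ih (X \ {y}).ncard
      (by rw [← h]; exact Set.ncard_sdiff_singleton_lt_of_mem hy hX) (hX.subset Set.sdiff_subset) rfl
    refine ⟨Y, hYX.trans Set.sdiff_subset, ?_, hirr⟩
    rw [hY]
    have := Submodule.span_insert_eq_span hyX
    rw [Set.insert_sdiff_singleton, Set.insert_eq_of_mem hy] at this
    exact this.symm

/-- An irredundant generator of a pointed finitely generated cone spans an exposed ray. -/
theorem exists_exposing_functional {E : Type*} [AddCommGroup E] [Module ℝ E]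
    [TopologicalSpace E] [IsTopologicalAddGroup E] [ContinuousSMul ℝ E] [LocallyConvexSpace ℝ E]
    [T2Space E] {Y : Set E} (hY : Y.Finite) (f : StrongDual ℝ E) (hf : ∀ y ∈ Y, 0 < f y) {g : E}
    (hg : g ∈ Y) (hirr : g ∉ PointedCone.hull ℝ (Y \ {g})) :
    ∃ h : StrongDual ℝ E, h g = 0 ∧ ∀ y ∈ Y, y ≠ g → 0 < h y := by
  have hsub : convexHull ℝ (Y \ {g}) ⊆ (PointedCone.hull ℝ (Y \ {g}) : Set E) :=
    convexHull_min PointedCone.subset_hull (PointedCone.convex _)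
  have hfpos : convexHull ℝ (Y \ {g}) ⊆ {x | 0 < f x} :=
    convexHull_min (fun y hy => hf y hy.1) (convex_halfSpace_gt f.toLinearMap.isLinear 0)
  -- The whole line through `g` is separated, so that the functional, bounded below on it, must
  -- vanish on it.
  have hdisj : Disjoint (convexHull ℝ (Y \ {g})) (Submodule.span ℝ {g} : Set E) := by
    rw [Set.disjoint_left]
    rintro x hx hxg
    obtain ⟨t, rfl⟩ := Submodule.mem_span_singleton.1 hxg
    have h1 : 0 < f (t • g) := hfpos hx
    rw [map_smul, smul_eq_mul] at h1
    have ht : 0 < t := pos_of_mul_pos_left h1 (hf g hg).le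
    apply hirr
    have h2 := (PointedCone.hull ℝ (Y \ {g})).smul_mem (inv_pos.2 ht).le (hsub hx)
    rwa [inv_smul_smul₀ ht.ne'] at h2
  obtain ⟨h, u, c, hu, huc, hc⟩ := geometric_hahn_banach_compact_closed (convex_convexHull ℝ _)
    ((hY.subset Set.sdiff_subset).isCompact_convexHull (𝕜 := ℝ)) (Submodule.span ℝ {g}).convex
    (Submodule.closed_of_finiteDimensional (Submodule.span ℝ {g})) hdisj
  have hg0 : h g = 0 := by
    by_contra hne
    have := hc ((c / h g) • g) (Submodule.smul_mem _ _ (Submodule.mem_span_singleton_self g))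
    rw [map_smul, smul_eq_mul, div_mul_cancel₀ _ hne] at this
    exact lt_irrefl _ this
  have hc0 : c < 0 := by simpa using hc 0 (Submodule.zero_mem _)
  refine ⟨-h, by simp [hg0], fun y hy hyg => ?_⟩
  have := hu y (subset_convexHull ℝ _ ⟨hy, hyg⟩)
  simp only [neg_apply]
  linarith

/-! ### Sublattices and primitive vectors -/

/-- The index of a subgroup of `ℤⁿ` that contains `n` independent vectors is at most the absolute
value of their determinant. -/
theorem card_quotient_le_natAbs_det {n : ℕ} (H : AddSubgroup (Fin n → ℤ))
    (u : Fin n → Fin n → ℤ) (hu : ∀ i, u i ∈ H) (hdet : (Matrix.of u).det ≠ 0) :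
    ENat.card ((Fin n → ℤ) ⧸ H) ≤ ((Matrix.of u).det.natAbs : ℕ∞) := by
  classical
  have hli : LinearIndependent ℤ u := Matrix.linearIndependent_rows_of_det_ne_zero hdet
  let N : Submodule ℤ (Fin n → ℤ) := Submodule.span ℤ (Set.range u)
  have hcard := Submodule.natAbs_det_basis_change (Pi.basisFun ℤ (Fin n)) N (Module.Basis.span hli)
  have hcomp : ((↑) ∘ (Module.Basis.span hli) : Fin n → Fin n → ℤ) = u := by
    ext i
    simp [Module.Basis.span_apply]
  have hdet' : (Pi.basisFun ℤ (Fin n)).det u = (Matrix.of u).det := by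
    rw [Pi.basisFun_det]
    rfl
  rw [hcomp, hdet'] at hcard
  have hpos : 0 < Nat.card ((Fin n → ℤ) ⧸ N) := by
    rw [← hcard]
    exact Int.natAbs_pos.2 hdet
  have hfin : Finite ((Fin n → ℤ) ⧸ N) := Nat.finite_of_card_ne_zero hpos.ne'
  have hNH : N.toAddSubgroup ≤ H := by
    have : N ≤ AddSubgroup.toIntSubmodule H := Submodule.span_le.2 (by
      rintro _ ⟨i, rfl⟩
      exact hu i)
    exact this
  let proj : ((Fin n → ℤ) ⧸ N) → ((Fin n → ℤ) ⧸ H) :=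
    Quotient.map' id fun x y hxy => by
      rw [Submodule.quotientRel_def] at hxy
      rw [QuotientAddGroup.leftRel_apply]
      have := H.neg_mem (hNH hxy)
      simpa [sub_eq_add_neg, add_comm] using this
  have h_proj : Function.Surjective proj := by
    intro y
    obtain ⟨x, rfl⟩ := QuotientAddGroup.mk_surjective y
    exact ⟨Submodule.Quotient.mk x, rfl⟩
  have hfin' : Finite ((Fin n → ℤ) ⧸ H) := Finite.of_surjective proj h_proj
  rw [ENat.card_eq_coe_natCard, hcard]
  exact_mod_cast Nat.card_le_card_of_surjective proj h_proj

theorem toReal_add {n : ℕ} (x y : Fin n → ℤ) : toReal (x + y) = toReal x + toReal y := by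
  ext i; simp [toReal]

/-- The map `toReal` as an additive homomorphism. -/
def toRealHom (n : ℕ) : (Fin n → ℤ) →+ (Fin n → ℝ) where
  toFun := toReal
  map_zero' := by ext i; simp [toReal]
  map_add' := toReal_add

theorem toReal_injective {n : ℕ} : Function.Injective (toReal (n := n)) := by
  intro x y h
  ext i
  have := congrFun h i
  simpa [toReal] using this

theorem toReal_zero {n : ℕ} : toReal (0 : Fin n → ℤ) = 0 := map_zero (toRealHom n)

theorem toReal_neg {n : ℕ} (x : Fin n → ℤ) : toReal (-x) = -toReal x := map_neg (toRealHom n) x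

theorem toReal_zsmul {n : ℕ} (m : ℤ) (x : Fin n → ℤ) : toReal (m • x) = (m : ℝ) • toReal x := by
  ext i; simp [toReal]

theorem toReal_nsmul {n : ℕ} (m : ℕ) (x : Fin n → ℤ) : toReal (m • x) = (m : ℝ) • toReal x := by
  ext i; simp [toReal]

theorem toReal_sum {n : ℕ} {ι : Type*} (s : Finset ι) (x : ι → Fin n → ℤ) :
    toReal (∑ i ∈ s, x i) = ∑ i ∈ s, toReal (x i) := map_sum (toRealHom n) x s

/-- Every integer vector is a multiple of a primitive one. -/
theorem exists_primitive_multiple {n : ℕ} {k : Fin n → ℤ} (hk : k ≠ 0) :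
    ∃ r : Fin n → ℤ, IsPrimitiveVector r ∧ ∃ s : ℕ, 0 < s ∧ k = s • r := by
  obtain ⟨i₀, hi₀⟩ := Function.ne_iff.1 hk
  obtain ⟨r, hr, hgcd⟩ := Finset.extract_gcd (s := Finset.univ) k ⟨i₀, Finset.mem_univ _⟩
  have hg0 : Finset.univ.gcd k ≠ 0 := by
    intro h
    exact hi₀ (by simpa [h] using hr i₀ (Finset.mem_univ _))
  have hgn : 0 ≤ Finset.univ.gcd k := by
    exact Int.nonneg_of_normalize_eq_self Finset.normalize_gcd
  refine ⟨r, fun d hd => ?_, (Finset.univ.gcd k).toNat, by omega, ?_⟩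
  · rw [isUnit_iff_dvd_one, ← hgcd]
    exact Finset.dvd_gcd fun i _ => hd i
  · ext i
    rw [Pi.smul_apply, nsmul_eq_mul, hr i (Finset.mem_univ _), Int.toNat_of_nonneg hgn]

/-- If a real multiple of a primitive vector is an integer vector, the factor is an integer. -/
theorem IsPrimitiveVector.exists_int_of_smul {n : ℕ} {r k : Fin n → ℤ} (hr : IsPrimitiveVector r)
    {s : ℝ} (h : s • toReal r = toReal k) : ∃ m : ℤ, s = m := by
  have htop : Submodule.span ℤ (Set.range r) = ⊤ := by
    obtain ⟨d, hd⟩ := (IsPrincipalIdealRing.principal (Submodule.span ℤ (Set.range r))).principal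
    have hdu : IsUnit d := hr d fun i => by
      have : r i ∈ Submodule.span ℤ (Set.range r) := Submodule.subset_span ⟨i, rfl⟩
      rw [hd] at this
      exact Ideal.mem_span_singleton.1 this
    rw [hd]
    exact Ideal.span_singleton_eq_top.2 hdu
  -- A Bézout relation among the coordinates of `r`, applied to `s • r = k`, expresses `s` as an
  -- integer.
  obtain ⟨c, hc⟩ := (Submodule.mem_span_range_iff_exists_fun ℤ).1
    (htop ▸ Submodule.mem_top : (1 : ℤ) ∈ Submodule.span ℤ (Set.range r))
  refine ⟨∑ i, c i * k i, ?_⟩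
  have hc' : ∑ i, (c i : ℝ) * r i = 1 := by exact_mod_cast hc
  calc s = s * ∑ i, (c i : ℝ) * r i := by rw [hc', mul_one]
    _ = ∑ i, (c i : ℝ) * k i := by
      rw [Finset.mul_sum]
      refine Finset.sum_congr rfl fun i _ => ?_
      have : s * r i = k i := congrFun h i
      rw [← this]
      ring
    _ = _ := by push_cast; rfl

/-! ### Lattice points of an irrational cone -/

variable {n : ℕ} {b : Module.Basis (Fin n) ℝ (Fin n → ℝ)}

theorem mem_simplicialCone_iff {x : Fin n → ℝ} :
    x ∈ simplicialCone b ↔ ∀ i, 0 ≤ b.coord i x := by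
  constructor
  · rintro ⟨c, hc, rfl⟩ i
    simp [Finsupp.single_apply, hc i]
  · intro h
    exact ⟨fun i => b.coord i x, h, by simp⟩

/-- The integer points in the interior of the simplicial cone generated by `b`. -/
def interiorPoints (b : Module.Basis (Fin n) ℝ (Fin n → ℝ)) : Set (Fin n → ℤ) :=
  {z | ∀ i, 0 < b.coord i (toReal z)}

/-- A vanishing coordinate would put the point in the plane of a proper face. -/
theorem IsIrrational.mem_interiorPoints (hb : IsIrrational b) {z : Fin n → ℤ} (hz : z ≠ 0)
    (hzC : toReal z ∈ simplicialCone b) : z ∈ interiorPoints b := by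
  intro i
  refine lt_of_le_of_ne (mem_simplicialCone_iff.1 hzC i) fun h => hz ?_
  refine hb {i}ᶜ (by simp) z ?_
  rw [← b.sum_repr (toReal z)]
  refine Submodule.sum_mem _ fun j _ => ?_
  by_cases hji : j = i
  · have h' : b.repr (toReal z) i = 0 := h.symm
    rw [hji, h', zero_smul]
    exact Submodule.zero_mem _
  · exact Submodule.smul_mem _ _ (Submodule.subset_span ⟨j, hji, rfl⟩)

theorem interiorPoints_ne_zero (hn : 0 < n) {z : Fin n → ℤ} (hz : z ∈ interiorPoints b) :
    z ≠ 0 := by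
  rintro rfl
  have := hz ⟨0, hn⟩
  simp [toReal_zero] at this

theorem kleinPolyhedron_eq (hn : 0 < n) (hb : IsIrrational b) :
    kleinPolyhedron (simplicialCone b) = convexHull ℝ (toReal '' interiorPoints b) := by
  unfold kleinPolyhedron
  congr 1
  ext x
  constructor
  · rintro ⟨hx, z, hz, rfl⟩
    exact ⟨z, hb.mem_interiorPoints hz hx, rfl⟩
  · rintro ⟨z, hz, rfl⟩
    exact ⟨mem_simplicialCone_iff.2 fun i => (hz i).le, z, interiorPoints_ne_zero hn hz, rfl⟩

theorem add_mem_interiorPoints {z z' : Fin n → ℤ} (hz : z ∈ interiorPoints b)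
    (hz' : z' ∈ interiorPoints b) : z + z' ∈ interiorPoints b := by
  intro i
  rw [toReal_add, map_add]
  exact add_pos (hz i) (hz' i)

/-- Large multiples of an interior point absorb any integer vector. -/
theorem exists_nsmul_add_mem_interiorPoints {w : Fin n → ℤ} (hw : w ∈ interiorPoints b)
    (z : Fin n → ℤ) : ∃ m : ℕ, m • w + z ∈ interiorPoints b := by
  have h : ∀ᶠ m : ℕ in Filter.atTop, ∀ i, 0 < (m : ℝ) * b.coord i (toReal w) +
      b.coord i (toReal z) := by
    rw [Filter.eventually_all]
    intro i
    have ht : Filter.Tendsto (fun m : ℕ => (m : ℝ) * b.coord i (toReal w) + b.coord i (toReal z))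
        Filter.atTop Filter.atTop :=
      Filter.tendsto_atTop_add_const_right _ _
        (tendsto_natCast_atTop_atTop.atTop_mul_const (hw i))
    exact ht.eventually_gt_atTop 0
  obtain ⟨m, hm⟩ := h.exists
  refine ⟨m, fun i => ?_⟩
  rw [toReal_add, toReal_nsmul, map_add, map_smul, smul_eq_mul]
  exact hm i

theorem span_range_toReal : Submodule.span ℝ (Set.range (toReal (n := n))) = ⊤ := by
  rw [eq_top_iff, ← (Pi.basisFun ℝ (Fin n)).span_eq]
  refine Submodule.span_mono ?_
  rintro _ ⟨i, rfl⟩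
  refine ⟨Pi.single i 1, ?_⟩
  ext j
  by_cases h : j = i
  · subst h; simp [toReal]
  · simp [toReal, h]

/-- The translates to the origin of the interior points span the whole space. -/
theorem span_sub_interiorPoints {w : Fin n → ℤ} (hw : w ∈ interiorPoints b) :
    Submodule.span ℝ (toReal '' {z | w + z ∈ interiorPoints b}) = ⊤ := by
  rw [eq_top_iff, ← span_range_toReal, Submodule.span_le]
  rintro _ ⟨z, rfl⟩
  obtain ⟨m, hm⟩ := exists_nsmul_add_mem_interiorPoints hw z
  have h1 : toReal w ∈ Submodule.span ℝ (toReal '' {z | w + z ∈ interiorPoints b}) :=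
    Submodule.subset_span ⟨w, add_mem_interiorPoints hw hw, rfl⟩
  have h2 : toReal (m • w + z) ∈ Submodule.span ℝ (toReal '' {z | w + z ∈ interiorPoints b}) :=
    Submodule.subset_span ⟨_, add_mem_interiorPoints hw hm, rfl⟩
  have h3 := Submodule.sub_mem _ h2 (Submodule.smul_mem _ (m : ℝ) h1)
  rwa [toReal_add, toReal_nsmul, add_sub_cancel_left] at h3

/-! ### The cone of the polyhedron at a vertex -/

/-- `Y` is a finite irredundant set of integer vectors which generates the cone of the
polyhedron `K` at its vertex `w`; it lies on the positive side of `f`. -/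
structure IsLocalFrame (b : Module.Basis (Fin n) ℝ (Fin n → ℝ)) (w : Fin n → ℤ)
    (f : StrongDual ℝ (Fin n → ℝ)) (Y : Set (Fin n → ℝ)) : Prop where
  mem : w ∈ interiorPoints b
  finite : Y.Finite
  integral : ∀ y ∈ Y, ∃ k : Fin n → ℤ, toReal k = y ∧ w + k ∈ interiorPoints b
  pos : ∀ y ∈ Y, 0 < f y
  f_pos : ∀ z, w + z ∈ interiorPoints b → z ≠ 0 → 0 < f (toReal z)
  generates : ∀ z, w + z ∈ interiorPoints b → toReal z ∈ PointedCone.hull ℝ Y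
  irredundant : ∀ y ∈ Y, y ∉ PointedCone.hull ℝ (Y \ {y})

/-- The functional exposing the vertex is strict on all other lattice points of the polyhedron. This
supplies the positivity that `exists_finite_generating` needs; the generators are then thinned out.
-/
theorem exists_isLocalFrame (hn : 0 < n) (hb : IsIrrational b) {v : Fin n → ℝ}
    (hv : IsSailVertex (simplicialCone b) v) :
    ∃ w f Y, toReal w = v ∧ IsLocalFrame b w f Y := by
  obtain ⟨⟨-, hexp, -⟩, -⟩ := hv
  have hvert : v ∈ toReal '' interiorPoints b := by
    have h := isExtreme_singleton.1 hexp.isExtreme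
    rw [kleinPolyhedron_eq hn hb] at h
    exact extremePoints_convexHull_subset h
  obtain ⟨w, hw, rfl⟩ := hvert
  obtain ⟨l, hl⟩ := hexp ⟨_, rfl⟩
  have hK : ∀ z ∈ interiorPoints b, toReal z ∈ kleinPolyhedron (simplicialCone b) := by
    intro z hz
    rw [kleinPolyhedron_eq hn hb]
    exact subset_convexHull ℝ _ ⟨z, hz, rfl⟩
  have hmax : ∀ y ∈ kleinPolyhedron (simplicialCone b), l y ≤ l (toReal w) := by
    have : toReal w ∈ ({toReal w} : Set (Fin n → ℝ)) := rfl
    rw [hl] at this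
    exact this.2
  have hf : ∀ z, w + z ∈ interiorPoints b → z ≠ 0 → 0 < (-l) (toReal z) := by
    intro z hz hz0
    have h1 := hmax _ (hK _ hz)
    have h2 : l (toReal z) ≠ 0 := by
      intro h0
      have : toReal (w + z) ∈ ({toReal w} : Set (Fin n → ℝ)) := by
        rw [hl]
        refine ⟨hK _ hz, fun y hy => ?_⟩
        rw [toReal_add, map_add, h0, add_zero]
        exact hmax y hy
      have h3 : toReal (w + z) = toReal w := this
      have h4 := toReal_injective h3
      exact hz0 (by simpa using h4)
    rw [toReal_add, map_add] at h1
    rw [neg_apply]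
    have : l (toReal z) < 0 := lt_of_le_of_ne (by linarith) h2
    linarith
  have hmem : ∀ z, (∀ i, 0 < b.coord i (toReal w) +
      ((b.coord i : (Fin n → ℝ) →+ ℝ).comp (toRealHom n)) z) ↔ w + z ∈ interiorPoints b := by
    intro z
    refine forall_congr' fun i => ?_
    rw [toReal_add, map_add]
    rfl
  obtain ⟨G, hGfin, hG, hgen⟩ := exists_finite_generating
    (fun i => (b.coord i : (Fin n → ℝ) →+ ℝ).comp (toRealHom n))
    (fun i => b.coord i (toReal w)) hw
    (((-l : StrongDual ℝ (Fin n → ℝ)) : (Fin n → ℝ) →+ ℝ).comp (toRealHom n))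
    (fun z hz hz0 => hf z ((hmem z).1 hz) hz0)
  obtain ⟨Y, hYG, hY, hirr⟩ := exists_irredundant_hull_eq (hGfin.image toReal)
  refine ⟨w, -l, Y, rfl, hw, (hGfin.image _).subset hYG, ?_, ?_, hf, ?_, hirr⟩
  · intro y hy
    obtain ⟨k, hk, rfl⟩ := hYG hy
    exact ⟨k, rfl, (hmem k).1 (hG k hk).2⟩
  · intro y hy
    obtain ⟨k, hk, rfl⟩ := hYG hy
    exact hf k ((hmem k).1 (hG k hk).2) (hG k hk).1
  · intro z hz
    rw [hY]
    have h1 : AddSubmonoid.closure G ≤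
        ((PointedCone.hull ℝ (toReal '' G)).toAddSubmonoid).comap (toRealHom n) :=
      AddSubmonoid.closure_le.2 fun g hg => PointedCone.subset_hull ⟨g, hg, rfl⟩
    exact h1 (hgen z ((hmem z).2 hz))

namespace IsLocalFrame

variable {w : Fin n → ℤ} {f : StrongDual ℝ (Fin n → ℝ)} {Y : Set (Fin n → ℝ)}

theorem span_eq_top (hY : IsLocalFrame b w f Y) : Submodule.span ℝ Y = ⊤ := by
  rw [eq_top_iff, ← span_sub_interiorPoints hY.mem, Submodule.span_le]
  rintro _ ⟨z, hz, rfl⟩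
  exact PointedCone.hull_le_span ℝ Y (hY.generates z hz)

theorem add_mem (hY : IsLocalFrame b w f Y) (hn : 0 < n) (hb : IsIrrational b)
    {y : Fin n → ℝ} (hy : y ∈ Y) : toReal w + y ∈ kleinPolyhedron (simplicialCone b) := by
  obtain ⟨k, rfl, hk⟩ := hY.integral y hy
  rw [kleinPolyhedron_eq hn hb, ← toReal_add]
  exact subset_convexHull ℝ _ ⟨_, hk, rfl⟩

theorem vertex_mem (hY : IsLocalFrame b w f Y) (hn : 0 < n) (hb : IsIrrational b) :
    toReal w ∈ kleinPolyhedron (simplicialCone b) := by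
  rw [kleinPolyhedron_eq hn hb]
  exact subset_convexHull ℝ _ ⟨_, hY.mem, rfl⟩

theorem sub_mem_hull (hY : IsLocalFrame b w f Y) (hn : 0 < n) (hb : IsIrrational b)
    {x : Fin n → ℝ} (hx : x ∈ kleinPolyhedron (simplicialCone b)) :
    x - toReal w ∈ PointedCone.hull ℝ Y := by
  rw [kleinPolyhedron_eq hn hb] at hx
  have hconv : Convex ℝ ((fun x => x - toReal w) ⁻¹' (PointedCone.hull ℝ Y : Set (Fin n → ℝ))) := by
    have := (PointedCone.convex (PointedCone.hull ℝ Y)).translate_preimage_right (-toReal w)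
    simpa [sub_eq_add_neg, add_comm] using this
  refine convexHull_min ?_ hconv hx
  rintro _ ⟨z, hz, rfl⟩
  have h := hY.generates (z - w) (by simpa using hz)
  have e : toReal (z - w) = toReal z - toReal w := map_sub (toRealHom n) z w
  rwa [e] at h

/-- A face of the polyhedron through the vertex `w` is generated locally by the elements of the
frame that are parallel to it. -/
theorem sub_mem_hull_of_face (hY : IsLocalFrame b w f Y) (hn : 0 < n) (hb : IsIrrational b)
    {l : StrongDual ℝ (Fin n → ℝ)}
    (hl : ∀ y ∈ kleinPolyhedron (simplicialCone b), l y ≤ l (toReal w)) {x : Fin n → ℝ}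
    (hx : x ∈ kleinPolyhedron (simplicialCone b)) (hlx : l x = l (toReal w)) :
    x - toReal w ∈ PointedCone.hull ℝ {y | y ∈ Y ∧ l y = 0} := by
  obtain ⟨c, hcs, hc0, hcx⟩ := PointedCone.mem_hull_set.1 (hY.sub_mem_hull hn hb hx)
  refine PointedCone.mem_hull_set.2 ⟨c, fun y hy => ⟨hcs hy, ?_⟩, hc0, hcx⟩
  -- Since `l` is nonpositive on the frame, a nonnegative combination with `l = 0` uses only
  -- generators with `l = 0`.
  have hle : ∀ y ∈ c.support, c y * l y ≤ 0 := by
    intro y hy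
    have := hl _ (hY.add_mem hn hb (hcs hy))
    rw [map_add] at this
    exact mul_nonpos_of_nonneg_of_nonpos (hc0 y) (by linarith)
  have hsum : ∑ y ∈ c.support, c y * l y = 0 := by
    have h1 : l (x - toReal w) = 0 := by rw [map_sub, hlx, sub_self]
    rw [← hcx, Finsupp.sum, map_sum] at h1
    simpa using h1
  have h0 := (Finset.sum_eq_zero_iff_of_nonpos hle).1 hsum y hy
  rcases mul_eq_zero.1 h0 with h | h
  · exact absurd h (Finsupp.mem_support_iff.1 hy)
  · exact h

end IsLocalFrame

/-! ### Edges at the vertex -/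

/-- A point where a nonzero linear form attains its maximum on a set is not an interior point. -/
theorem notMem_interior_of_forall_le {E : Type*} [AddCommGroup E] [Module ℝ E]
    [TopologicalSpace E] [ContinuousAdd E] [ContinuousSMul ℝ E] {K : Set E} {l : StrongDual ℝ E}
    (hl0 : l ≠ 0) {x : E} (hl : ∀ y ∈ K, l y ≤ l x) : x ∉ interior K := by
  intro hx
  obtain ⟨u, hu⟩ : ∃ u, 0 < l u := by
    by_contra! h
    apply hl0
    ext u
    have h1 := h u
    have h2 := h (-u)
    rw [map_neg] at h2
    simp only [zero_apply]
    linarith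
  have hcont : Continuous fun t : ℝ => x + t • u := by fun_prop
  have hev : ∀ᶠ t in nhds (0 : ℝ), x + t • u ∈ K := by
    have : Filter.Tendsto (fun t : ℝ => x + t • u) (nhds 0) (nhds x) := by
      simpa using hcont.tendsto 0
    exact this (mem_interior_iff_mem_nhds.1 hx)
  obtain ⟨t, ht, ht0⟩ := ((hev.filter_mono nhdsWithin_le_nhds).and
    (self_mem_nhdsWithin : Set.Ioi (0 : ℝ) ∈ nhdsWithin 0 (Set.Ioi 0))).exists
  have := hl _ ht
  rw [map_add, map_smul, smul_eq_mul] at this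
  have : 0 < t * l u := mul_pos ht0 hu
  linarith

theorem IsPrimitiveVector.ne_zero {r : Fin n → ℤ} (hr : IsPrimitiveVector r) : r ≠ 0 := by
  rintro rfl
  have := hr 2 (by simp)
  rw [Int.isUnit_iff] at this
  omega

namespace IsLocalFrame

variable {w : Fin n → ℤ} {f : StrongDual ℝ (Fin n → ℝ)} {Y : Set (Fin n → ℝ)}

/-- The elements of the frame are multiples of edge vectors. -/
theorem exists_edgeVector (hY : IsLocalFrame b w f Y) (hn : 2 ≤ n) (hb : IsIrrational b)
    {y : Fin n → ℝ} (hy : y ∈ Y) :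
    ∃ r ∈ edgeVectors (simplicialCone b) (toReal w), ∃ s : ℕ, 0 < s ∧ y = (s : ℝ) • toReal r := by
  have hn0 : 0 < n := by omega
  set K := kleinPolyhedron (simplicialCone b) with hK
  obtain ⟨h, hhy, hhpos⟩ :=
    exists_exposing_functional hY.finite f hY.pos hy (hY.irredundant y hy)
  -- If `h` vanished, the frame would be the single vector `y`, which cannot span a space of
  -- dimension at least 2.
  have hh0 : h ≠ 0 := by
    rintro rfl
    have hsub : Y ⊆ {y} := by
      intro y' hy'
      by_contra hne
      simpa using hhpos y' hy' hne
    have h1 : Module.finrank ℝ (Submodule.span ℝ ({y} : Set (Fin n → ℝ))) ≤ 1 :=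
      (finrank_span_le_card _).trans (by simp)
    have h2 : Submodule.span ℝ ({y} : Set (Fin n → ℝ)) = ⊤ := by
      rw [eq_top_iff, ← hY.span_eq_top]
      exact Submodule.span_mono hsub
    rw [h2, finrank_top, Module.finrank_fin_fun] at h1
    omega
  have hmax : ∀ x ∈ K, (-h) x ≤ (-h) (toReal w) := by
    intro x hx
    have h1 : ∀ u ∈ PointedCone.hull ℝ Y, 0 ≤ h u := by
      intro u hu
      obtain ⟨c, hcs, hc0, rfl⟩ := PointedCone.mem_hull_set.1 hu
      rw [Finsupp.sum, map_sum]
      refine Finset.sum_nonneg fun i hi => ?_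
      rw [map_smul, smul_eq_mul]
      refine mul_nonneg (hc0 i) ?_
      by_cases hiy : i = y
      · rw [hiy, hhy]
      · exact (hhpos i (hcs hi) hiy).le
    have h2 := h1 _ (hY.sub_mem_hull hn0 hb hx)
    rw [map_sub] at h2
    simp only [neg_apply]
    linarith
  let E : Set (Fin n → ℝ) := {x | x ∈ K ∧ ∀ z ∈ K, (-h) z ≤ (-h) x}
  have hwK : toReal w ∈ K := hY.vertex_mem hn0 hb
  have hyK : toReal w + y ∈ K := hY.add_mem hn0 hb hy
  have hwE : toReal w ∈ E := ⟨hwK, hmax⟩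
  have hyE : toReal w + y ∈ E := by
    refine ⟨hyK, fun z hz => ?_⟩
    rw [map_add, neg_apply h y, hhy, neg_zero, add_zero]
    exact hmax z hz
  have hy0 : y ≠ 0 := by
    rintro rfl
    simpa using hY.pos 0 hy
  have hElin : ∀ x ∈ E, x - toReal w ∈ Submodule.span ℝ {y} := by
    intro x hx
    have hlx : (-h) x = (-h) (toReal w) := le_antisymm (hmax x hx.1) (hx.2 _ hwK)
    have h1 := hY.sub_mem_hull_of_face hn0 hb hmax hx.1 hlx
    refine Submodule.span_mono ?_ (PointedCone.hull_le_span ℝ _ h1)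
    rintro y' ⟨hy', hhy'⟩
    by_contra hne
    have := hhpos y' hy' hne
    rw [neg_apply] at hhy'
    linarith
  have hdir : (affineSpan ℝ E).direction = Submodule.span ℝ {y} := by
    rw [direction_affineSpan]
    apply le_antisymm
    · rw [vectorSpan_def, Submodule.span_le]
      rintro _ ⟨x, hx, x', hx', rfl⟩
      have := Submodule.sub_mem _ (hElin x hx) (hElin x' hx')
      simpa using this
    · rw [Submodule.span_singleton_le_iff_mem]
      have := vsub_mem_vectorSpan ℝ hyE hwE
      simpa using this
  have hface : IsSailFace (simplicialCone b) 1 E := by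
    refine ⟨⟨⟨_, hwE⟩, fun _ => ⟨-h, rfl⟩, ?_⟩, ?_⟩
    · rw [hdir, finrank_span_singleton hy0]
    · intro x hx
      exact ⟨subset_closure hx.1,
        notMem_interior_of_forall_le (neg_ne_zero.2 hh0) hx.2⟩
  obtain ⟨k, rfl, -⟩ := hY.integral y hy
  have hk0 : k ≠ 0 := by
    rintro rfl
    exact hy0 toReal_zero
  obtain ⟨r, hr, s, hs, hks⟩ := exists_primitive_multiple hk0
  have hks' : toReal k = (s : ℝ) • toReal r := by rw [hks, toReal_nsmul]
  refine ⟨r, ⟨hr, E, hface, hwE, s, by exact_mod_cast hs, ?_⟩, s, hs, hks'⟩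
  rw [← hks']
  exact hyE

/-- Needed because `starDet` is a `finsum`, which defaults to 0 on infinite support. Each edge is
parallel to some frame vector; this is a nonzero integer multiple of the primitive `r`, which
confines `r` to a box. -/
theorem finite_edgeVectors (hY : IsLocalFrame b w f Y) (hn : 0 < n) (hb : IsIrrational b) :
    (edgeVectors (simplicialCone b) (toReal w)).Finite := by
  have key : ∀ r ∈ edgeVectors (simplicialCone b) (toReal w), ∃ k : Fin n → ℤ,
      toReal k ∈ Y ∧ r ∈ Set.Icc (-|k|) |k| := by
    rintro r ⟨hr, E, ⟨⟨-, hexp, hdim⟩, -⟩, hwE, t, ht, hrE⟩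
    obtain ⟨l, hl⟩ := hexp ⟨_, hwE⟩
    have hmax : ∀ x ∈ kleinPolyhedron (simplicialCone b), l x ≤ l (toReal w) := by
      rw [hl] at hwE
      exact hwE.2
    have hrK := hrE
    rw [hl] at hrK
    have hlr : l (toReal w + t • toReal r) = l (toReal w) :=
      le_antisymm (hmax _ hrK.1) (hrK.2 _ (hY.vertex_mem hn hb))
    have h1 := hY.sub_mem_hull_of_face hn hb hmax hrK.1 hlr
    rw [add_sub_cancel_left] at h1
    have hr0 : toReal r ≠ 0 := fun h => hr.ne_zero (toReal_injective (h.trans toReal_zero.symm))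
    obtain ⟨y, hy, hly⟩ : {y | y ∈ Y ∧ l y = 0}.Nonempty := by
      by_contra hne
      rw [Set.not_nonempty_iff_eq_empty] at hne
      rw [hne] at h1
      have h2 : t • toReal r = 0 := by simpa [PointedCone.hull] using h1
      exact (smul_ne_zero ht.ne' hr0) h2
    obtain ⟨k, rfl, -⟩ := hY.integral y hy
    have hkE : toReal w + toReal k ∈ E := by
      rw [hl]
      refine ⟨hY.add_mem hn hb hy, fun z hz => ?_⟩
      rw [map_add, hly, add_zero]
      exact hmax z hz
    have hrd : toReal r ∈ (affineSpan ℝ E).direction := by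
      have := AffineSubspace.vsub_mem_direction (subset_affineSpan ℝ E hrE)
        (subset_affineSpan ℝ E hwE)
      rw [vsub_eq_sub, add_sub_cancel_left] at this
      have h3 := Submodule.smul_mem _ t⁻¹ this
      rwa [inv_smul_smul₀ ht.ne'] at h3
    have hkd : toReal k ∈ (affineSpan ℝ E).direction := by
      have := AffineSubspace.vsub_mem_direction (subset_affineSpan ℝ E hkE)
        (subset_affineSpan ℝ E hwE)
      rwa [vsub_eq_sub, add_sub_cancel_left] at this
    obtain ⟨c, hc⟩ := (finrank_eq_one_iff_of_nonzero'
      (⟨toReal r, hrd⟩ : (affineSpan ℝ E).direction) (by simpa [Subtype.ext_iff] using hr0)).1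
      hdim ⟨toReal k, hkd⟩
    have hc' : c • toReal r = toReal k := congrArg Subtype.val hc
    obtain ⟨m, rfl⟩ := hr.exists_int_of_smul hc'
    have hk0 : toReal k ≠ 0 := by
      intro h
      have := hY.pos _ hy
      rw [h, map_zero] at this
      exact lt_irrefl _ this
    have hm0 : m ≠ 0 := by
      rintro rfl
      apply hk0
      rw [← hc']
      simp
    have hmr : m • r = k := toReal_injective (by rw [toReal_zsmul, hc'])
    refine ⟨k, hy, ?_⟩
    have habs : ∀ i, |r i| ≤ |k i| := by
      intro i
      rw [← hmr, Pi.smul_apply, smul_eq_mul, abs_mul]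
      have : 1 ≤ |m| := Int.one_le_abs hm0
      nlinarith [abs_nonneg (r i)]
    exact ⟨fun i => (abs_le.1 (habs i)).1, fun i => (abs_le.1 (habs i)).2⟩
  have hfin : (⋃ k ∈ toReal ⁻¹' Y, Set.Icc (-|k|) |k|).Finite :=
    (hY.finite.preimage toReal_injective.injOn).biUnion fun k _ => Set.finite_Icc _ _
  refine hfin.subset fun r hr => ?_
  obtain ⟨k, hk, hkr⟩ := key r hr
  exact Set.mem_biUnion hk hkr

end IsLocalFrame

/-! ### Determinants and coefficients of edge vectors -/

/-- Every determinant of `n` edge vectors is bounded by the determinant of the edge star. -/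
theorem natAbs_det_le_starDet {C : Set (Fin n → ℝ)} {v : Fin n → ℝ}
    (hfin : (edgeVectors C v).Finite) (r : Fin n → Fin n → ℤ) (hr : ∀ i, r i ∈ edgeVectors C v) :
    (Matrix.of r).det.natAbs ≤ starDet C v := by
  classical
  by_cases hinj : Function.Injective r
  · let s : Finset (Fin n → ℤ) := Finset.univ.image r
    have hs : s.card = n := by
      rw [Finset.card_image_of_injective _ hinj, Finset.card_univ, Fintype.card_fin]
    have hsub : (s : Set (Fin n → ℤ)) ⊆ edgeVectors C v := by
      intro x hx
      obtain ⟨i, -, rfl⟩ := Finset.mem_image.1 hx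
      exact hr i
    have hbij : Function.Bijective fun i => (⟨r i, Finset.mem_image_of_mem r (Finset.mem_univ i)⟩ :
        s) := by
      constructor
      · intro i j hij
        exact hinj (congrArg Subtype.val hij)
      · rintro ⟨x, hx⟩
        obtain ⟨i, -, rfl⟩ := Finset.mem_image.1 hx
        exact ⟨i, rfl⟩
    let e := Equiv.ofBijective _ hbij
    let σ : Equiv.Perm (Fin n) := (s.equivFinOfCardEq hs).symm.trans e.symm
    have hσ : ∀ i, r (σ i) = ((s.equivFinOfCardEq hs).symm i : Fin n → ℤ) := by
      intro i
      have : e (σ i) = (s.equivFinOfCardEq hs).symm i := by simp [σ]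
      rw [← this]
      rfl
    have habs : absDet s hs = (Matrix.of r).det.natAbs := by
      have hm : (Matrix.of fun i : Fin n => ((s.equivFinOfCardEq hs).symm i : Fin n → ℤ)) =
          (Matrix.of r).submatrix σ id := by
        ext i j
        simp [← hσ]
      rw [absDet, hm, Matrix.det_permute, Int.natAbs_mul]
      simp
    have hfinite : Finite {s : Finset (Fin n → ℤ) //
        (s : Set (Fin n → ℤ)) ⊆ edgeVectors C v ∧ s.card = n} := by
      refine Finite.of_injective (β := hfin.toFinset.powerset)
        (fun s => ⟨s.1, Finset.mem_powerset.2 fun x hx => hfin.mem_toFinset.2 (s.2.1 hx)⟩) ?_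
      intro s t hst
      exact Subtype.ext (Subtype.mk.inj hst)
    rw [← habs]
    exact single_le_finsum (⟨s, hsub, hs⟩ : {s : Finset (Fin n → ℤ) //
      (s : Set (Fin n → ℤ)) ⊆ edgeVectors C v ∧ s.card = n}) (f := fun s => absDet s.1 s.2.2)
      (Set.toFinite _) fun _ => Nat.zero_le _
  · rw [Function.Injective] at hinj
    push Not at hinj
    obtain ⟨i, j, hij, hne⟩ := hinj
    rw [Matrix.det_zero_of_row_eq hne (M := Matrix.of r) hij]
    simp

/-- A vector in the cone generated by a spanning set `Y` is a nonnegative combination of a basis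
contained in `Y`. -/
theorem exists_basis_nonneg_sum {Y : Set (Fin n → ℝ)} (hspan : Submodule.span ℝ Y = ⊤)
    {x : Fin n → ℝ} (hx : x ∈ PointedCone.hull ℝ Y) :
    ∃ (u : Fin n → Fin n → ℝ) (c : Fin n → ℝ), (∀ i, u i ∈ Y) ∧ (∀ i, 0 ≤ c i) ∧
      x = ∑ i, c i • u i := by
  classical
  obtain ⟨c, hcs, hc0, rfl⟩ := PointedCone.mem_hull_set.1 hx
  obtain ⟨t, hts, hti, d, hd, hsum⟩ := exists_linearIndepOn_sum_eq c.support c fun x _ => hc0 x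
  have htY : (t : Set (Fin n → ℝ)) ⊆ Y := fun x hx => hcs (hts hx)
  -- Carathéodory may use fewer than `n` vectors; the added ones get coefficient 0.
  obtain ⟨B, hBY, htB, hYB, hB⟩ := exists_linearIndepOn_extension hti htY
  rw [Set.image_id, Set.image_id] at hYB
  have hBspan : Submodule.span ℝ B = ⊤ := by
    rw [eq_top_iff, ← hspan]
    exact Submodule.span_le.2 hYB
  let bB : Module.Basis B ℝ (Fin n → ℝ) := Module.Basis.mk hB (by
    simp only [id, Subtype.range_coe_subtype, Set.ofPred_mem_eq, hBspan, le_refl])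
  let e : Fin n ≃ B := (Pi.basisFun ℝ (Fin n)).indexEquiv bB
  refine ⟨fun i => e i, fun i => if (e i : Fin n → ℝ) ∈ t then d (e i) else 0,
    fun i => hBY (e i).2, ?_, ?_⟩
  · intro i
    dsimp only
    split_ifs with h
    · exact hd _ h
    · exact le_rfl
  · have : Fintype B := Fintype.ofEquiv _ e
    rw [Equiv.sum_comp e fun x : B => (if (x : Fin n → ℝ) ∈ t then d x else 0) • (x : Fin n → ℝ),
      Finsupp.sum, ← hsum]
    rw [← Finset.sum_coe_sort t]
    refine Finset.sum_bij_ne_zero (fun x _ _ => ⟨x.1, htB x.2⟩) ?_ ?_ ?_ ?_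
    · intros; exact Finset.mem_univ _
    · intro x _ _ y _ _ h
      exact Subtype.ext (Subtype.mk.inj h)
    · intro y _ hy
      by_cases hyt : (y : Fin n → ℝ) ∈ t
      · refine ⟨⟨y, hyt⟩, Finset.mem_univ _, ?_, rfl⟩
        simpa [hyt] using hy
      · simp [hyt] at hy
    · intro x _ _
      simp [x.2]

namespace IsLocalFrame

variable {w : Fin n → ℤ} {f : StrongDual ℝ (Fin n → ℝ)} {Y : Set (Fin n → ℝ)}

/-- The primitive vector of an element of the frame leads from the vertex to an interior point. -/
theorem add_mem_of_nsmul_mem (hY : IsLocalFrame b w f Y) {r : Fin n → ℤ} {s : ℕ} (hs : 0 < s)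
    (hrs : (s : ℝ) • toReal r ∈ Y) : w + r ∈ interiorPoints b := by
  obtain ⟨k, hk, hwk⟩ := hY.integral _ hrs
  intro i
  have h1 := hY.mem i
  have h2 := hwk i
  rw [toReal_add, map_add, hk, map_smul, smul_eq_mul] at h2
  rw [toReal_add, map_add]
  -- The point `w + r` lies on the segment from `w` to `w + s • r`.
  have hs1 : (1 : ℝ) ≤ s := by exact_mod_cast hs
  by_contra! h3
  nlinarith

/-- The coefficients of the vertex with respect to vectors leading to interior points cannot all
be large. -/
theorem sum_add_one_le (hY : IsLocalFrame b w f Y) (hn : 2 ≤ n)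
    {r : Fin n → Fin n → ℤ} (hr : ∀ i, w + r i ∈ interiorPoints b)
    (hfr : ∀ i, 0 < f (toReal (r i))) {lam : Fin n → ℝ} (h0 : ∀ i, 0 ≤ lam i)
    (hw : toReal w = ∑ i, lam i • toReal (r i)) :
    ∑ i, lam i + 1 ≤ (n : ℝ) ^ (6 * (n)! - 2) := by
  by_contra! hlarge
  obtain ⟨y, hy0, hypos, hylt, hyle⟩ := exists_integer_vector_below hn lam h0 hlarge
  set S := ∑ i, lam i with hS
  set T : ℝ := ((∑ i, y i : ℤ) : ℝ) with hT
  have hTsum : ∑ i, (y i : ℝ) = T := by rw [hT]; push_cast; rfl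
  have hS0 : 0 ≤ S := Finset.sum_nonneg fun i _ => h0 i
  have hN : 0 < S + 1 := by linarith
  have hz : toReal (-∑ i, y i • r i) = -∑ i, (y i : ℝ) • toReal (r i) := by
    rw [toReal_neg, toReal_sum]
    simp only [toReal_zsmul]
  -- As `(S + 1) • w` is the sum of the `lam i • (w + r i)`, these are coefficients of the lattice
  -- point `w - ∑ y i • r i` in terms of the points `w + r i`.
  let μ : Fin n → ℝ := fun i => (1 + T) / (S + 1) * lam i - y i
  have hμ0 : ∀ i, 0 ≤ μ i := by
    intro i
    have h := hyle i
    rw [← le_div_iff₀ hN, mul_div_right_comm] at h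
    exact sub_nonneg.2 h
  have hμsum : ∑ i, μ i = (S - T) / (S + 1) := by
    simp only [μ, Finset.sum_sub_distrib, ← Finset.mul_sum, hTsum, ← hS]
    field_simp
    ring
  have hμpos : 0 < ∑ i, μ i := by
    rw [hμsum]
    exact div_pos (by linarith) hN
  have hrep : toReal (w + -∑ i, y i • r i) = ∑ i, μ i • toReal (w + r i) := by
    simp only [toReal_add, smul_add, Finset.sum_add_distrib, ← Finset.sum_smul, hz, hμsum]
    simp only [μ, sub_smul, Finset.sum_sub_distrib, mul_smul, ← Finset.smul_sum, ← hw]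
    have h1 : (S - T) / (S + 1) + (1 + T) / (S + 1) = 1 := by
      field_simp
      ring
    have h2 : ((S - T) / (S + 1)) • toReal w + ((1 + T) / (S + 1)) • toReal w = toReal w := by
      rw [← add_smul, h1, one_smul]
    rw [← add_sub_assoc, h2, sub_eq_add_neg]
  have hint : w + -∑ i, y i • r i ∈ interiorPoints b := by
    intro j
    rw [hrep, map_sum]
    obtain ⟨i₀, -, hi₀⟩ := Finset.exists_lt_of_sum_lt
      (by simpa using hμpos : ∑ _i : Fin n, (0 : ℝ) < ∑ i, μ i)
    refine Finset.sum_pos' (fun i _ => ?_) ⟨i₀, Finset.mem_univ _, ?_⟩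
    · rw [map_smul, smul_eq_mul]
      exact mul_nonneg (hμ0 i) (hr i j).le
    · rw [map_smul, smul_eq_mul]
      exact mul_pos hi₀ (hr i₀ j)
  have hfneg : f (toReal (-∑ i, y i • r i)) < 0 := by
    rw [hz, map_neg, map_sum, neg_lt_zero]
    obtain ⟨i₀, -, hi₀⟩ := Finset.exists_lt_of_sum_lt
      (by simpa using hypos : ∑ _i : Fin n, (0 : ℤ) < ∑ i, y i)
    refine Finset.sum_pos' (fun i _ => ?_) ⟨i₀, Finset.mem_univ _, ?_⟩
    · rw [map_smul, smul_eq_mul]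
      exact mul_nonneg (by exact_mod_cast hy0 i) (hfr i).le
    · rw [map_smul, smul_eq_mul]
      exact mul_pos (by exact_mod_cast hi₀) (hfr i₀)
  have hpos := hY.f_pos _ hint fun h => by
    rw [h, toReal_zero, map_zero] at hfneg
    exact lt_irrefl _ hfneg
  linarith

/-- The edge vectors in a facet through the vertex span its direction, and the affine hull of the
facet does not contain the origin. -/
theorem exists_facet_edgeVectors {m : ℕ} {b : Module.Basis (Fin (m + 1)) ℝ (Fin (m + 1) → ℝ)}
    {w : Fin (m + 1) → ℤ} {f : StrongDual ℝ (Fin (m + 1) → ℝ)} {Y : Set (Fin (m + 1) → ℝ)}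
    (hY : IsLocalFrame b w f Y) (hm : 2 ≤ m + 1)
    (hb : IsIrrational b) {F : Set (Fin (m + 1) → ℝ)}
    (hF : IsFaceOfDim (kleinPolyhedron (simplicialCone b)) m F) (hwF : toReal w ∈ F) :
    ∃ g : Fin m → Fin (m + 1) → ℤ,
      (∀ j, g j ∈ edgeVectors (simplicialCone b) (toReal w)) ∧
      (∀ j, toReal (w + g j) ∈ affineSpan ℝ F) ∧
      LinearIndependent ℝ (Fin.cons (toReal w) fun j => toReal (g j) :
        Fin (m + 1) → Fin (m + 1) → ℝ) := by
  have hn : 0 < m + 1 := by omega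
  obtain ⟨-, hexp, hdim⟩ := hF
  obtain ⟨l, hl⟩ := hexp ⟨_, hwF⟩
  have hmax : ∀ x ∈ kleinPolyhedron (simplicialCone b), l x ≤ l (toReal w) := by
    rw [hl] at hwF
    exact hwF.2
  have hwK := hY.vertex_mem hn hb
  have hmemF : ∀ x ∈ kleinPolyhedron (simplicialCone b), l x = l (toReal w) → x ∈ F := by
    intro x hx hlx
    rw [hl]
    exact ⟨hx, fun z hz => hlx ▸ hmax z hz⟩
  -- If `l` vanished at `w`, the bound at the points `k • w + z` would give `l ≤ 0` on all of `ℤⁿ`,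
  -- hence `l = 0` there, and the face would have full dimension.
  have hlw : l (toReal w) ≠ 0 := by
    intro hlw
    have hle : ∀ z, l (toReal z) ≤ 0 := by
      intro z
      obtain ⟨k, hk⟩ := exists_nsmul_add_mem_interiorPoints hY.mem z
      have h1 : toReal (k • w + z) ∈ kleinPolyhedron (simplicialCone b) := by
        rw [kleinPolyhedron_eq hn hb]
        exact subset_convexHull ℝ _ ⟨_, hk, rfl⟩
      have h2 := hmax _ h1
      rwa [toReal_add, toReal_nsmul, map_add, map_smul, hlw, smul_zero, zero_add] at h2
    have hzero : ∀ z, l (toReal z) = 0 := by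
      intro z
      have h1 := hle z
      have h2 := hle (-z)
      rw [toReal_neg, map_neg] at h2
      linarith
    have htop : (affineSpan ℝ F).direction = ⊤ := by
      rw [eq_top_iff, ← hY.span_eq_top, Submodule.span_le]
      intro y hy
      have hyK := hY.add_mem hn hb hy
      obtain ⟨k, rfl, -⟩ := hY.integral y hy
      have h1 := hmemF _ hyK (by rw [map_add, hzero, hzero, add_zero])
      have := AffineSubspace.vsub_mem_direction (subset_affineSpan ℝ F h1)
        (subset_affineSpan ℝ F hwF)
      simpa using this
    rw [htop, finrank_top, Module.finrank_fin_fun] at hdim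
    omega
  have hdirle : (affineSpan ℝ F).direction ≤ Submodule.span ℝ {y | y ∈ Y ∧ l y = 0} := by
    have hsub : ∀ x ∈ F, x - toReal w ∈ Submodule.span ℝ {y | y ∈ Y ∧ l y = 0} := by
      intro x hx
      rw [hl] at hx
      exact PointedCone.hull_le_span ℝ _
        (hY.sub_mem_hull_of_face hn hb hmax hx.1 (le_antisymm (hmax x hx.1) (hx.2 _ hwK)))
    rw [direction_affineSpan, vectorSpan_def, Submodule.span_le]
    rintro _ ⟨x, hx, x', hx', rfl⟩
    have := Submodule.sub_mem _ (hsub x hx) (hsub x' hx')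
    simpa using this
  have hrank : m ≤ Module.finrank ℝ (Submodule.span ℝ {y | y ∈ Y ∧ l y = 0}) := by
    exact hdim.symm.le.trans (Submodule.finrank_mono hdirle)
  obtain ⟨u, hu, -, huli⟩ := Submodule.exists_fun_fin_finrank_span_eq ℝ {y | y ∈ Y ∧ l y = 0}
  have hedge : ∀ j : Fin m, ∃ r ∈ edgeVectors (simplicialCone b) (toReal w),
      ∃ s : ℕ, 0 < s ∧ u (Fin.castLE hrank j) = (s : ℝ) • toReal r :=
    fun j => hY.exists_edgeVector hm hb (hu _).1
  choose g hg s hs hgs using hedge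
  have hsR : ∀ j, (s j : ℝ) ≠ 0 := fun j => by exact_mod_cast (hs j).ne'
  have hgu : ∀ j, toReal (g j) = (s j : ℝ)⁻¹ • u (Fin.castLE hrank j) := by
    intro j
    rw [hgs, inv_smul_smul₀ (hsR j)]
  refine ⟨g, hg, fun j => ?_, ?_⟩
  · have h1 : toReal w + u (Fin.castLE hrank j) ∈ F :=
      hmemF _ (hY.add_mem hn hb (hu _).1) (by rw [map_add, (hu _).2, add_zero])
    have h2 := AffineSubspace.vsub_mem_direction (subset_affineSpan ℝ F h1)
      (subset_affineSpan ℝ F hwF)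
    rw [vsub_eq_sub, add_sub_cancel_left] at h2
    have h3 := AffineSubspace.vadd_mem_of_mem_direction
      (Submodule.smul_mem _ (s j : ℝ)⁻¹ h2) (subset_affineSpan ℝ F hwF)
    rw [vadd_eq_add, ← hgu, ← toReal_add, add_comm (g j)] at h3
    exact h3
  · rw [linearIndependent_finCons]
    constructor
    · have h1 : LinearIndependent ℝ fun j : Fin m => u (Fin.castLE hrank j) :=
        huli.comp _ (Fin.castLE_injective hrank)
      have h2 := h1.units_smul fun j => Units.mk0 (s j : ℝ)⁻¹ (inv_ne_zero (hsR j))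
      have e : (fun j => toReal (g j)) = ((fun j => Units.mk0 (s j : ℝ)⁻¹ (inv_ne_zero (hsR j))) •
          fun j : Fin m => u (Fin.castLE hrank j)) := funext hgu
      rw [e]
      exact h2
    · intro hmem
      apply hlw
      have hker : Submodule.span ℝ (Set.range fun j => toReal (g j)) ≤ l.toLinearMap.ker := by
        rw [Submodule.span_le]
        rintro _ ⟨j, rfl⟩
        have : l (toReal (g j)) = 0 := by rw [hgu, map_smul, (hu _).2, smul_zero]
        exact this
      exact hker hmem

end IsLocalFrame

theorem det_map_toReal (u : Fin n → Fin n → ℤ) :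
    (Matrix.of fun i => toReal (u i)).det = ((Matrix.of u).det : ℝ) := by
  rw [Int.cast_det]
  rfl

end KleinSail

end

/-! ### The estimate of the integer distance -/

open KleinSail in
theorem corollary1 (n : ℕ) (hn : 2 ≤ n)
    (b : Module.Basis (Fin n) ℝ (Fin n → ℝ)) (hb : KleinSail.IsIrrational b)
    (v : Fin n → ℝ) (hv : KleinSail.IsSailVertex (KleinSail.simplicialCone b) v)
    (F : Set (Fin n → ℝ)) (hF : KleinSail.IsSailFace (KleinSail.simplicialCone b) (n - 1) F)
    (hvF : v ∈ F) :
    KleinSail.intDist F 0 <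
      (((n * KleinSail.starDet (KleinSail.simplicialCone b) v) ^ (8 * n !) : ℕ) : ℕ∞) := by
  obtain ⟨m, rfl⟩ : ∃ m, n = m + 1 := ⟨n - 1, by omega⟩
  have hn0 : 0 < m + 1 := by omega
  obtain ⟨w, f, Y, rfl, hY⟩ := exists_isLocalFrame hn0 hb hv
  set D := starDet (simplicialCone b) (toReal w) with hD
  have hfin := hY.finite_edgeVectors hn0 hb
  obtain ⟨g, hg, hgF, hgli⟩ := hY.exists_facet_edgeVectors hn hb hF.1 hvF
  -- The vector from the vertex to the lattice point `w + w` is `w` itself, so `w` lies in the cone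
  -- of the frame.
  obtain ⟨u, c, huY, hc0, hwsum⟩ := exists_basis_nonneg_sum hY.span_eq_top
    (hY.generates w (add_mem_interiorPoints hY.mem hY.mem))
  choose r hr s hs hus using fun i => hY.exists_edgeVector hn hb (huY i)
  have hsR : ∀ i, (0 : ℝ) < s i := fun i => by exact_mod_cast hs i
  let lam : Fin (m + 1) → ℝ := fun i => c i * s i
  have hlam0 : ∀ i, 0 ≤ lam i := fun i => mul_nonneg (hc0 i) (hsR i).le
  have hwlam : toReal w = ∑ i, lam i • toReal (r i) := by
    rw [hwsum]
    refine Finset.sum_congr rfl fun i _ => ?_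
    rw [hus i, smul_smul]
  have hS := hY.sum_add_one_le hn
    (fun i => hY.add_mem_of_nsmul_mem (hs i) (hus i ▸ huY i))
    (fun i => by
      have := hY.pos _ (huY i)
      rw [hus i, map_smul, smul_eq_mul] at this
      exact pos_of_mul_pos_right this (hsR i).le) hlam0 hwlam
  -- The determinant as a linear function of its first row, the other rows being the edge vectors of
  -- the facet.
  let φ' : (Fin (m + 1) → ℝ) →ₗ[ℝ] ℝ :=
    (Matrix.detRowAlternating (R := ℝ) (n := Fin (m + 1))).toMultilinearMap.toLinearMap
      (Fin.cons 0 fun j => toReal (g j)) 0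
  have hφ' : ∀ z, φ' (toReal z) =
      ((Matrix.of (Fin.cons z g : Fin (m + 1) → Fin (m + 1) → ℤ)).det : ℝ) := by
    intro z
    rw [← det_map_toReal]
    have h1 : φ' (toReal z) = Matrix.det (Function.update (Fin.cons 0 fun j => toReal (g j)) 0
      (toReal z) : Fin (m + 1) → Fin (m + 1) → ℝ) := rfl
    rw [h1, Fin.update_cons_zero]
    congr 1
    ext i j
    refine Fin.cases ?_ (fun i => ?_) i <;> simp
  set Δ := (Matrix.of (Fin.cons w g : Fin (m + 1) → Fin (m + 1) → ℤ)).det with hΔ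
  have hΔ0 : Δ ≠ 0 := by
    intro h
    have h1 : IsUnit (Matrix.of fun i => toReal
        ((Fin.cons w g : Fin (m + 1) → Fin (m + 1) → ℤ) i)) := by
      rw [← Matrix.linearIndependent_rows_iff_isUnit]
      have e : (Matrix.of fun i => toReal ((Fin.cons w g : Fin (m + 1) → Fin (m + 1) → ℤ) i)) =
          (Fin.cons (toReal w) fun j => toReal (g j) : Fin (m + 1) → Fin (m + 1) → ℝ) := by
        ext i j
        refine Fin.cases ?_ (fun i => ?_) i <;> simp
      rw [e]
      exact hgli
    rw [Matrix.isUnit_iff_isUnit_det, det_map_toReal, ← hΔ, h, Int.cast_zero] at h1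
    exact not_isUnit_zero h1
  have hdist : intDist F 0 ≤ (Δ.natAbs : ℕ∞) := by
    refine card_quotient_le_natAbs_det _ _ (fun i => ?_) hΔ0
    have hw : w ∈ AddSubgroup.closure {z : Fin (m + 1) → ℤ | toReal (z + 0) ∈ affineSpan ℝ F} :=
      AddSubgroup.subset_closure (by
        simpa using subset_affineSpan ℝ F hvF)
    refine Fin.cases (by simpa using hw) (fun j => ?_) i
    have h1 : w + g j ∈
        AddSubgroup.closure {z : Fin (m + 1) → ℤ | toReal (z + 0) ∈ affineSpan ℝ F} :=
      AddSubgroup.subset_closure (by simpa using hgF j)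
    have h2 := sub_mem h1 hw
    rw [add_sub_cancel_left] at h2
    simpa using h2
  have hΔle : (Δ.natAbs : ℝ) ≤ (∑ i, lam i) * D := by
    rw [Nat.cast_natAbs, Int.cast_abs, hΔ, ← hφ', hwlam, map_sum, Finset.sum_mul]
    refine (Finset.abs_sum_le_sum_abs _ _).trans (Finset.sum_le_sum fun i _ => ?_)
    rw [map_smul, smul_eq_mul, abs_mul, abs_of_nonneg (hlam0 i), hφ', ← Int.cast_abs,
      ← Nat.cast_natAbs]
    refine mul_le_mul_of_nonneg_left ?_ (hlam0 i)
    exact_mod_cast natAbs_det_le_starDet hfin _ fun j =>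
      Fin.cases (by simpa using hr i) (fun j => by simpa using hg j) j
  -- Positivity of `D` makes the final inequality strict, since `∑ lam i` is at least 1 below its
  -- bound.
  have hD0 : 0 < D := by
    rcases Nat.eq_zero_or_pos D with h | h
    · have h1 : (1 : ℝ) ≤ Δ.natAbs := by exact_mod_cast Int.natAbs_pos.2 hΔ0
      rw [h] at hΔle
      rw [Nat.cast_zero, mul_zero] at hΔle
      linarith
    · exact h
  have hlt : Δ.natAbs < (m + 1) ^ (6 * (m + 1)! - 2) * D := by
    have hDR : (0 : ℝ) < D := by exact_mod_cast hD0
    have : (Δ.natAbs : ℝ) < ((m + 1 : ℕ) : ℝ) ^ (6 * (m + 1)! - 2) * D := by nlinarith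
    exact_mod_cast this
  refine lt_of_le_of_lt hdist ?_
  have hfac : 1 ≤ (m + 1)! := Nat.factorial_pos _
  have hfinal : (m + 1) ^ (6 * (m + 1)! - 2) * D ≤ ((m + 1) * D) ^ (8 * (m + 1)!) := by
    rw [mul_pow]
    exact Nat.mul_le_mul (Nat.pow_le_pow_right hn0 (by omega))
      (Nat.le_self_pow (by omega) D)
  exact_mod_cast lt_of_lt_of_le hlt hfinal
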